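/- Let $d\ge 0$, write $G=\mathbb Z^d$, and let $M\subset G$ be a finite subset. Let $V$ be a finite vector space over a field and let $S=\mathcal L(V^M,V)$ be the set of linear maps $V^M\to V$. For $s\in S^{G}$, let $\sigma_s\colon V^{G}\to V^{G}$ be the linear non-uniform cellular automaton (NUCA) $$\sigma_s(x)(g)=s(g)\big((x(g+m))_{m\in M}\big),\qquad x\in V^G,\ g\in G.$$ Call two configurations in $V^G$ asymptotic if they agree outside a finite subset of $G$. A map $\tau\colon V^G\to V^G$ is post-surjective if for all $x,y\in V^G$ with $y$ asymptotic to $\tau(x)$ there is $z\in V^G$ asymptotic to $x$ with $\tau(z)=y$. The NUCA $\sigma_s$ is stably post-surjective if $\sigma_p$ is post-surjective for every $p\in\Sigma(s)$, where $\Sigma(s)\subset S^G$ is the closure, in the product of the discrete topologies, of the set of all translates $h\mapsto s(h-g)$, $g\in G$. It has bounded singularity if for every finite $E\subset G$ there are integers $a_j\le b_j$ $(1\le j\le d)$ such that the box $K=\prod_{j=1}^d\{a_j,\dots,b_j\}$ contains $E$ and $s(g)=s(k)$ for every $g\in (K+E)\setminus K$, where $k$ is the unique element of $K$ with $k_j\equiv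 g_j \pmod{b_j-a_j+1}$ for all $j$. If $\sigma_s$ is stably post-surjective and has bounded singularity, then $\sigma_s$ is invertible: it is bijective, and there are a finite set $N\subset G$ and maps $t(g)\colon V^N\to V$ $(g\in G)$ such that $\sigma_s^{-1}(y)(g)=t(g)\big((y(g+n))_{n\in N}\big)$ for all $y\in V^G$ and $g\in G$. -/

import Mathlib

namespace NonUniformCA

open scoped Pointwise

section General

variable {G : Type*} [AddGroup G] {A S : Type*}

/-- Two configurations are asymptotic if they agree outside a finite subset of the universe. -/
def Asymptotic (x y : G → A) : Prop :=
  ∃ E : Set G, E.Finite ∧ ∀ g, g ∉ E → x g = y g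

/-- The Bernoulli shift `(g x)(h) = x (g⁻¹ h)`, written additively. -/
def shift (g : G) (x : G → S) : G → S := fun h => x (-g + h)

/-- The smallest subshift `Σ(x)` containing `x`: the closure of the shift orbit of `x` for the
prodiscrete topology (the product of the discrete topologies `⊥` on the factors). -/
def orbitClosure (x : G → S) : Set (G → S) :=
  @closure (G → S) (@Pi.topologicalSpace G (fun _ => S) (fun _ => ⊥))
    (Set.range fun g : G => shift g x)

/-- The non-uniform cellular automaton with memory `M` and configuration `s` of local defining
maps: `σ_s(x)(g) = s(g)((g⁻¹ x)|_M)`. -/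
def nuca {M : Set G} (s : G → ((M → A) → A)) (x : G → A) : G → A :=
  fun g => s g (fun m : M => shift (-g) x m)

/-- Post-surjectivity of a self-map of the full shift. -/
def PostSurjective (τ : (G → A) → (G → A)) : Prop :=
  ∀ x y : G → A, Asymptotic y (τ x) → ∃ z : G → A, Asymptotic z x ∧ τ z = y

/-- Invertibility: the map is bijective and its inverse is a NUCA with finite memory. -/
def Invertible (τ : (G → A) → (G → A)) : Prop :=
  Function.Bijective τ ∧
    ∃ N : Set G, N.Finite ∧ ∃ t : G → ((N → A) → A),
      Function.LeftInverse (nuca t) τ ∧ Function.RightInverse (nuca t) τ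

end General

section Linear

variable {G : Type*} [AddGroup G] {k V : Type*} [Field k] [AddCommGroup V] [Module k V]

/-- The linear NUCA whose local defining maps are the linear maps `s g : V^M → V`. -/
def linearNuca {M : Set G} (s : G → ((M → V) →ₗ[k] V)) : (G → V) → (G → V) :=
  nuca fun g => (s g : (M → V) → V)

/-- Stable post-surjectivity: `σ_p` is post-surjective for every `p ∈ Σ(s)`. -/
def StablyPostSurjective {M : Set G} (s : G → ((M → V) →ₗ[k] V)) : Prop :=
  ∀ p ∈ orbitClosure s, PostSurjective (linearNuca p)

end Linear

/-- Bounded singularity of a configuration `s` over `ℤ^d`: every finite `E` is contained in a box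
`K = ∏ j, {a j, …, b j}` such that `s g = s k` for all `g ∈ (K + E) \ K`, where `k` is the point
of `K` congruent to `g` modulo the side lengths of `K`. -/
def BoundedSingularity {d : ℕ} {S : Type*} (s : (Fin d → ℤ) → S) : Prop :=
  ∀ E : Set (Fin d → ℤ), E.Finite → ∃ a b : Fin d → ℤ, a ≤ b ∧ E ⊆ Set.Icc a b ∧
    ∀ g ∈ (Set.Icc a b + E) \ Set.Icc a b, ∀ k ∈ Set.Icc a b,
      (∀ j, k j ≡ g j [ZMOD (b j - a j + 1)]) → s g = s k

end NonUniformCA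

namespace NonUniformCA

/-! ### Impulse responses and periodisation -/

section Basic

variable {G k V : Type*} [AddCommGroup G] [Field k] [AddCommGroup V] [Module k V]

/-! Compactness of `Σ(s)` gives one finite `N` such that every impulse at `g` has a preimage
supported in `g + N`; superposing these preimages gives a right inverse with finite memory. Only
injectivity then needs bounded singularity: `s` is made periodic along a large box without spoiling
the impulse preimages. On the finite set of periodic configurations the right inverse is two-sided,
and it is local, so it forces a kernel element to vanish at any cell deep inside the box
(`eq_zero_of_periodization`). -/

theorem linearNuca_apply {M : Set G} (s : G → ((M → V) →ₗ[k] V)) (x : G → V) (g : G) :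
    linearNuca s x g = s g (fun m : M => x (g + m)) := by
  simp [linearNuca, nuca, shift]

theorem linearNuca_zero {M : Set G} (s : G → ((M → V) →ₗ[k] V)) : linearNuca s 0 = 0 := by
  funext g
  rw [linearNuca_apply]
  exact map_zero (s g)

theorem linearNuca_sub {M : Set G} (s : G → ((M → V) →ₗ[k] V)) (x y : G → V) :
    linearNuca s (x - y) = linearNuca s x - linearNuca s y := by
  funext g
  simp only [Pi.sub_apply, linearNuca_apply]
  exact map_sub (s g) (fun m : M => x (g + m)) (fun m : M => y (g + m))

/-- The superposition of the impulse responses `z g (y g)`, where `z g v` lives on `g + N`. -/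
def superpose (N : Finset G) (z : G → V → G → V) (y : G → V) : G → V :=
  fun h => ∑ n ∈ N, z (h - n) (y (h - n)) h

theorem superpose_eq_sum [DecidableEq G] {N : Finset G} {z : G → V → G → V}
    (hz : ∀ g v h, z g v h ≠ 0 → h - g ∈ N) (y : G → V) (h : G) (F : Finset G)
    (hF : ∀ n ∈ N, h - n ∈ F) :
    superpose N z y h = ∑ g ∈ F, z g (y g) h := by
  have h1 : superpose N z y h = ∑ g ∈ N.image (fun n => h - n), z g (y g) h := by
    rw [Finset.sum_image (fun a _ b _ hab => sub_right_injective hab)]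
    rfl
  rw [h1]
  refine Finset.sum_subset ?_ ?_
  · intro g hg
    obtain ⟨n, hn, rfl⟩ := Finset.mem_image.1 hg
    exact hF n hn
  · intro g _ hg
    by_contra hne
    exact hg (Finset.mem_image.2 ⟨h - g, hz _ _ _ hne, by abel⟩)

theorem linearNuca_superpose [DecidableEq G] {M : Set G} (hM : M.Finite)
    (s : G → ((M → V) →ₗ[k] V)) {N : Finset G} {z : G → V → G → V}
    (hz : ∀ g v h, z g v h ≠ 0 → h - g ∈ N)
    (hσ : ∀ g v, linearNuca s (z g v) = Pi.single g v) (y : G → V) :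
    linearNuca s (superpose N z y) = y := by
  funext q
  -- All cells whose response can reach the window `q + M`, and `q` itself, where the impulse is
  -- read.
  let F : Finset G := insert q (Finset.image₂ (fun m n => q + m - n) hM.toFinset N)
  have h1 : (fun m : M => superpose N z y (q + m)) =
      ∑ g ∈ F, fun m : M => z g (y g) (q + m) := by
    funext m
    rw [Finset.sum_apply]
    refine superpose_eq_sum hz y _ F fun n hn => Finset.mem_insert_of_mem ?_
    exact Finset.mem_image₂_of_mem (hM.mem_toFinset.2 m.2) hn
  rw [linearNuca_apply, h1, map_sum]
  have h2 : ∀ g ∈ F, s q (fun m : M => z g (y g) (q + m)) =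
      (Pi.single g (y g) : G → V) q := by
    intro g _
    rw [← hσ, linearNuca_apply]
  rw [Finset.sum_congr rfl h2, Finset.sum_eq_single q]
  · simp
  · intro g _ hg
    exact Pi.single_eq_of_ne hg.symm _
  · intro hq
    exact absurd (Finset.mem_insert_self q _) hq

/-- Periodising the configuration of local maps along a retraction `r` keeps the impulse
responses, provided that it does not change the local maps near the fundamental domain. -/
theorem linearNuca_comp_single [DecidableEq G] {M : Set G} (s : G → ((M → V) →ₗ[k] V))
    {N : Finset G} {z : G → V → G → V} (hz : ∀ g v h, z g v h ≠ 0 → h - g ∈ N)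
    (hσ : ∀ g v, linearNuca s (z g v) = Pi.single g v) {r : G → G}
    (hr : ∀ g h, r (r g + h) = r (g + h))
    (hs : ∀ g, ∀ n ∈ N, ∀ m ∈ M, s (r (r g + (n - m))) = s (r g + (n - m))) (g : G) (v : V) :
    linearNuca (fun q => s (r q)) (fun h => z (r g) v (h - g + r g)) = Pi.single g v := by
  funext q
  have hq : r (q - g + r g) = r q := by
    rw [add_comm, hr]; congr 1; abel
  have h1 : s (r q) (fun m : M => z (r g) v (q - g + r g + m)) =
      s (q - g + r g) (fun m : M => z (r g) v (q - g + r g + m)) := by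
    -- Either the window misses the response and linearity makes the local map irrelevant, or the
    -- cell has the form `r g + (n - m)`, where periodising leaves `s` unchanged.
    by_cases h0 : (fun m : M => z (r g) v (q - g + r g + m)) = 0
    · rw [h0, map_zero, map_zero]
    · obtain ⟨m, hm⟩ := Function.ne_iff.1 h0
      have := hs g _ (hz _ _ _ hm) m m.2
      rw [show r g + (q - g + r g + ↑m - r g - ↑m) = q - g + r g by abel, hq] at this
      rw [this]
  rw [linearNuca_apply]
  have h2 : (fun m : M => z (r g) v (q + m - g + r g)) =
      fun m : M => z (r g) v (q - g + r g + m) := by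
    funext m; congr 1; abel
  rw [h2, h1, ← linearNuca_apply, hσ]
  by_cases hqg : q = g
  · subst hqg; simp
  · rw [Pi.single_eq_of_ne hqg, Pi.single_eq_of_ne]
    intro h
    apply hqg
    rwa [add_eq_right, sub_eq_zero] at h

/-- Near `g` the periodisation of `x` and of `s` agree with the originals, so the image of the
former vanishes on `g - N`, the only cells the right inverse reads at `g`. -/
theorem eq_zero_of_periodization [DecidableEq G] [Finite V] {M : Set G} (hM : M.Finite)
    (s : G → ((M → V) →ₗ[k] V)) {N : Finset G} {z : G → V → G → V}
    (hz : ∀ g v h, z g v h ≠ 0 → h - g ∈ N) (hz0 : ∀ g, z g 0 = 0)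
    (hσ : ∀ g v, linearNuca s (z g v) = Pi.single g v) {r : G → G}
    (hr : ∀ g h, r (r g + h) = r (g + h)) (hfin : (Set.range r).Finite)
    (hs : ∀ g, ∀ n ∈ N, ∀ m ∈ M, s (r (r g + (n - m))) = s (r g + (n - m)))
    {x : G → V} (hx : linearNuca s x = 0) {g : G} (hg : r g = g)
    (hgN : ∀ n ∈ N, r (g - n) = g - n)
    (hgM : ∀ n ∈ N, ∀ m ∈ M, r (g - n + m) = g - n + m) : x g = 0 := by
  have hrr : ∀ g, r (r g) = r g := fun g => by simpa using hr g 0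
  let z' : G → V → G → V := fun g v h => z (r g) v (h - g + r g)
  have hz' : ∀ g v h, z' g v h ≠ 0 → h - g ∈ N := by
    intro g v h hne
    simpa using hz _ _ _ hne
  have hσ' : ∀ y, linearNuca (fun q => s (r q)) (superpose N z' y) = y :=
    linearNuca_superpose hM _ hz' (linearNuca_comp_single s hz hσ hr hs)
  let P := {y : G → V // ∀ h, y (r h) = y h}
  have hP : Finite P := by
    have := hfin.to_subtype
    refine Finite.of_injective (fun (y : P) (q : Set.range r) => y.1 q) ?_
    intro y w hyw
    apply Subtype.ext
    funext h
    rw [← y.2 h, ← w.2 h]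
    exact congrFun hyw ⟨r h, h, rfl⟩
  let T : P → P := fun y => ⟨superpose N z' y.1, by
    intro h
    refine Finset.sum_congr rfl fun n _ => ?_
    have h1 : r (r h - n) = r (h - n) := by rw [sub_eq_add_neg, hr, ← sub_eq_add_neg]
    have h2 : y.1 (r h - n) = y.1 (h - n) := by rw [← y.2, h1, y.2]
    simp only [z', h1, h2, sub_sub_cancel]⟩
  let U : P → P := fun y => ⟨linearNuca (fun q => s (r q)) y.1, by
    intro h
    simp only [linearNuca_apply, hrr]
    congr 1
    funext m
    rw [← y.2, hr, y.2]⟩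
  have hUT : Function.LeftInverse U T := fun y => Subtype.ext (hσ' y.1)
  let w : P := ⟨fun h => x (r h), fun h => congrArg x (hrr h)⟩
  -- An injective self-map of a finite set is surjective, so the one-sided inverse is two-sided.
  have hTU : T (U w) = w :=
    hUT.rightInverse_of_surjective (Finite.surjective_of_injective hUT.injective) _
  have h3 := congrFun (congrArg Subtype.val hTU) g
  rw [show w.1 g = x g from congrArg x hg] at h3
  rw [← h3]
  refine Finset.sum_eq_zero fun n hn => ?_
  have h4 : linearNuca (fun q => s (r q)) (fun h => x (r h)) (g - n) = 0 := by
    rw [linearNuca_apply, hgN n hn]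
    have : (fun m : M => x (r (g - n + m))) = fun m : M => x (g - n + m) := by
      funext m; rw [hgM n hn m m.2]
    rw [this, ← linearNuca_apply, hx]; rfl
  change z' (g - n) (linearNuca (fun q => s (r q)) (fun h => x (r h)) (g - n)) g = 0
  rw [h4]
  simp [z', hz0]

theorem nuca_eq_superpose {N : Finset G} (z : G → V → G → V) (y : G → V) :
    nuca (M := Neg.neg '' (N : Set G))
      (fun g f => ∑ n : N, z (g - n) (f ⟨-n, n, n.2, rfl⟩) g) y = superpose N z y := by
  funext g
  simp only [nuca, shift, superpose, neg_neg, ← sub_eq_add_neg]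
  exact Finset.sum_coe_sort N (fun n => z (g - n) (y (g - n)) g)

end Basic

/-! ### Uniform support of impulse preimages -/

section Compactness

variable {G k V : Type*} [AddCommGroup G] [Field k] [AddCommGroup V] [Module k V]

theorem isOpen_setOf_linearNuca_eq_single [DecidableEq G] {M : Set G} (hM : M.Finite)
    [TopologicalSpace ((M → V) →ₗ[k] V)] [DiscreteTopology ((M → V) →ₗ[k] V)]
    {N : Finset G} {z : G → V} (hz : ∀ h, z h ≠ 0 → h ∈ N) (v : V) :
    IsOpen {p : G → ((M → V) →ₗ[k] V) | linearNuca p z = Pi.single 0 v} := by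
  -- Outside these cells both sides vanish for every `p`, so the condition involves finitely many
  -- coordinates.
  let F : Finset G := insert 0 (Finset.image₂ (fun n m => n - m) N hM.toFinset)
  have h1 : {p : G → ((M → V) →ₗ[k] V) | linearNuca p z = Pi.single 0 v} =
      ⋂ q ∈ F, (fun p : G → ((M → V) →ₗ[k] V) => p q) ⁻¹'
        {l | l (fun m : M => z (q + m)) = (Pi.single 0 v : G → V) q} := by
    ext p
    simp only [Set.mem_ofPred_eq, Set.mem_iInter, Set.mem_preimage]
    constructor
    · intro h q _
      rw [← linearNuca_apply, h]
    · intro h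
      funext q
      by_cases hq : q ∈ F
      · rw [linearNuca_apply, h q hq]
      · have h0 : (fun m : M => z (q + m)) = 0 := by
          funext m
          by_contra hne
          refine hq (Finset.mem_insert_of_mem (Finset.mem_image₂.2
            ⟨q + m, hz _ hne, m, hM.mem_toFinset.2 m.2, by abel⟩))
        rw [linearNuca_apply, h0, map_zero, Pi.single_eq_of_ne]
        rintro rfl
        exact hq (Finset.mem_insert_self _ _)
  rw [h1]
  exact isOpen_biInter_finset fun q _ => (isOpen_discrete _).preimage (continuous_apply q)

theorem StablyPostSurjective.exists_finset_orbitClosure [DecidableEq G] [Finite V] {M : Set G}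
    (hM : M.Finite) {s : G → ((M → V) →ₗ[k] V)} (hs : StablyPostSurjective s) :
    ∃ N : Finset G, ∀ p ∈ orbitClosure s, ∀ v : V, ∃ z : G → V,
      (∀ h, z h ≠ 0 → h ∈ N) ∧ linearNuca p z = Pi.single 0 v := by
  have := hM.to_subtype
  have : Finite ((M → V) →ₗ[k] V) := DFunLike.finite _
  let _ : TopologicalSpace ((M → V) →ₗ[k] V) := ⊥
  have : DiscreteTopology ((M → V) →ₗ[k] V) := ⟨rfl⟩
  have hc : IsCompact (orbitClosure s) := isClosed_closure.isCompact
  let U : Finset G → Set (G → ((M → V) →ₗ[k] V)) := fun N => ⋂ v : V, ⋃ z : G → V,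
    ⋃ _ : ∀ h, z h ≠ 0 → h ∈ N, {p | linearNuca p z = Pi.single 0 v}
  have hmem : ∀ N p, p ∈ U N ↔ ∀ v : V, ∃ z : G → V,
      (∀ h, z h ≠ 0 → h ∈ N) ∧ linearNuca p z = Pi.single 0 v := by
    intro N p
    simp only [U, Set.mem_iInter, Set.mem_iUnion, Set.mem_ofPred_eq, exists_prop]
  have hU : ∀ N, IsOpen (U N) := fun N => isOpen_iInter_of_finite fun v =>
    isOpen_iUnion fun z => isOpen_iUnion fun hz => isOpen_setOf_linearNuca_eq_single hM hz v
  have hmono : Monotone U := by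
    intro N N' hNN p hp
    rw [hmem] at hp ⊢
    intro v
    obtain ⟨z, hz, h⟩ := hp v
    exact ⟨z, fun g hg => hNN (hz g hg), h⟩
  have hcov : orbitClosure s ⊆ ⋃ N, U N := by
    intro p hp
    have hex : ∀ v : V, ∃ z : G → V, Asymptotic z 0 ∧ linearNuca p z = Pi.single 0 v := by
      intro v
      refine hs p hp 0 (Pi.single 0 v) ⟨{0}, Set.finite_singleton 0, fun g hg => ?_⟩
      rw [linearNuca_zero, Pi.single_eq_of_ne (by simpa using hg), Pi.zero_apply]
    choose z hz hpz using hex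
    choose E hE hzE using hz
    have hfin : (⋃ v, E v).Finite := Set.finite_iUnion hE
    refine Set.mem_iUnion.2 ⟨hfin.toFinset, (hmem _ _).2 fun v => ⟨z v, fun h hne => ?_, hpz v⟩⟩
    rw [hfin.mem_toFinset, Set.mem_iUnion]
    by_contra hno
    push Not at hno
    exact hne (hzE v h (hno v))
  obtain ⟨N, hN⟩ := hc.elim_directed_cover U hU hcov hmono.directed_le
  exact ⟨N, fun p hp => (hmem N p).1 (hN hp)⟩

theorem shift_mem_orbitClosure {S : Type*} (s : G → S) (g : G) : shift g s ∈ orbitClosure s :=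
  @subset_closure (G → S) (@Pi.topologicalSpace G (fun _ => S) (fun _ => ⊥)) _ _ ⟨g, rfl⟩

theorem StablyPostSurjective.exists_impulse [DecidableEq G] [Finite V] {M : Set G}
    (hM : M.Finite) {s : G → ((M → V) →ₗ[k] V)} (hs : StablyPostSurjective s) :
    ∃ (N : Finset G) (z : G → V → G → V), (∀ g v h, z g v h ≠ 0 → h - g ∈ N) ∧
      (∀ g, z g 0 = 0) ∧ ∀ g v, linearNuca s (z g v) = Pi.single g v := by
  obtain ⟨N, hN⟩ := hs.exists_finset_orbitClosure hM
  have key : ∀ g v, ∃ z : G → V, (∀ h, z h ≠ 0 → h - g ∈ N) ∧ (v = 0 → z = 0) ∧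
      linearNuca s z = Pi.single g v := by
    intro g v
    -- An arbitrary preimage of the zero impulse could be a nonzero kernel element.
    by_cases hv : v = 0
    · subst hv
      exact ⟨0, fun h hne => absurd rfl hne, fun _ => rfl, by rw [linearNuca_zero, Pi.single_zero]⟩
    obtain ⟨z, hz, hσ⟩ := hN _ (shift_mem_orbitClosure s (-g)) v
    refine ⟨fun h => z (h - g), fun h => hz _, fun h => absurd h hv, ?_⟩
    funext q
    have h1 := congrFun hσ (q - g)
    rw [linearNuca_apply] at h1 ⊢
    simp only [shift, neg_neg, add_sub_cancel] at h1
    simp only [add_sub_right_comm, h1]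
    by_cases hq : q = g
    · subst hq; simp
    · rw [Pi.single_eq_of_ne hq, Pi.single_eq_of_ne (sub_ne_zero.2 hq)]
  choose z h1 h2 h3 using key
  exact ⟨N, z, h1, fun g => h2 g 0 rfl, h3⟩

end Compactness

/-! ### Boxes and bounded singularity -/

section Box

open scoped Pointwise

variable {d : ℕ}

/-- The representative of `g` modulo the side lengths of the box `Set.Icc a b` in that box. -/
def boxReduce (a b g : Fin d → ℤ) : Fin d → ℤ :=
  fun j => a j + (g j - a j) % (b j - a j + 1)

theorem boxReduce_mem {a b : Fin d → ℤ} (hab : a ≤ b) (g : Fin d → ℤ) :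
    boxReduce a b g ∈ Set.Icc a b := by
  have h0 : ∀ j, 0 < b j - a j + 1 := fun j => by linarith [hab j]
  constructor
  · intro j
    have := Int.emod_nonneg (g j - a j) (h0 j).ne'
    simp only [boxReduce]; linarith
  · intro j
    have := Int.emod_lt_of_pos (g j - a j) (h0 j)
    simp only [boxReduce]; linarith

theorem boxReduce_modEq (a b g : Fin d → ℤ) (j : Fin d) :
    boxReduce a b g j ≡ g j [ZMOD (b j - a j + 1)] := by
  have := (Int.mod_modEq (g j - a j) (b j - a j + 1)).add_left (a j)
  simpa [boxReduce] using this

theorem boxReduce_of_mem {a b g : Fin d → ℤ} (hg : g ∈ Set.Icc a b) : boxReduce a b g = g := by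
  funext j
  have h1 := hg.1 j
  have h2 := hg.2 j
  rw [boxReduce, Int.emod_eq_of_lt (by linarith) (by linarith)]
  ring

theorem boxReduce_add (a b g h : Fin d → ℤ) :
    boxReduce a b (boxReduce a b g + h) = boxReduce a b (g + h) := by
  funext j
  have := ((boxReduce_modEq a b g j).add_right (h j)).sub_right (a j)
  exact congrArg (a j + ·) this

theorem boxReduce_periodic {S : Type*} {s : (Fin d → ℤ) → S} {a b : Fin d → ℤ} (hab : a ≤ b)
    {E : Set (Fin d → ℤ)}
    (hs : ∀ g ∈ (Set.Icc a b + E) \ Set.Icc a b, ∀ k ∈ Set.Icc a b,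
      (∀ j, k j ≡ g j [ZMOD (b j - a j + 1)]) → s g = s k)
    {k e : Fin d → ℤ} (hk : k ∈ Set.Icc a b) (he : e ∈ E) :
    s (boxReduce a b (k + e)) = s (k + e) := by
  by_cases h : k + e ∈ Set.Icc a b
  · rw [boxReduce_of_mem h]
  · exact (hs _ ⟨Set.add_mem_add hk he, h⟩ _ (boxReduce_mem hab _) (boxReduce_modEq a b _)).symm

theorem linearNuca_injective_of_impulse {d : ℕ} {k V : Type*} [Field k]
    [AddCommGroup V] [Module k V] [Finite V] {M : Set (Fin d → ℤ)} (hM : M.Finite)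
    {s : (Fin d → ℤ) → ((M → V) →ₗ[k] V)} (hsing : BoundedSingularity s)
    {N : Finset (Fin d → ℤ)} {z : (Fin d → ℤ) → V → (Fin d → ℤ) → V}
    (hz : ∀ g v h, z g v h ≠ 0 → h - g ∈ N) (hz0 : ∀ g, z g 0 = 0)
    (hσ : ∀ g v, linearNuca s (z g v) = Pi.single g v) :
    Function.Injective (linearNuca s) := by
  intro x y hxy
  have hx : linearNuca s (x - y) = 0 := by rw [linearNuca_sub, hxy, sub_self]
  funext g
  rw [← sub_eq_zero]
  have hN := N.finite_toSet
  -- The first three sets make the reduction fix `g`, `g - N` and `g - N + M`; `N - M` keeps `s`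
  -- unchanged wherever responses from the box are seen.
  obtain ⟨a, b, hab, hE, hs⟩ := hsing
    (({g} ∪ ({g} - (N : Set (Fin d → ℤ)))) ∪ (({g} - (N : Set (Fin d → ℤ)) + M) ∪ (N - M)))
    ((((Set.finite_singleton g).union ((Set.finite_singleton g).sub hN))).union
      ((((Set.finite_singleton g).sub hN).add hM).union (hN.sub hM)))
  have hgN : ∀ n ∈ N, g - n ∈ {g} - (N : Set (Fin d → ℤ)) := fun n hn =>
    Set.sub_mem_sub rfl hn
  refine eq_zero_of_periodization hM s hz hz0 hσ (boxReduce_add a b)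
    ((Set.finite_Icc a b).subset ?_) ?_ hx (g := g) ?_ ?_ ?_
  · rintro _ ⟨q, rfl⟩
    exact boxReduce_mem hab q
  · intro q n hn m hm
    exact boxReduce_periodic hab hs (boxReduce_mem hab q) (Or.inr (Or.inr (Set.sub_mem_sub hn hm)))
  · exact boxReduce_of_mem (hE (Or.inl (Or.inl rfl)))
  · intro n hn
    exact boxReduce_of_mem (hE (Or.inl (Or.inr (hgN n hn))))
  · intro n hn m hm
    exact boxReduce_of_mem (hE (Or.inr (Or.inl (Set.add_mem_add (hgN n hn) hm))))

end Box

end NonUniformCA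

theorem mainTheorem9 {d : ℕ} {k V : Type*} [Field k] [AddCommGroup V] [Module k V] [Finite V]
    (M : Set (Fin d → ℤ)) (hM : M.Finite)
    (s : (Fin d → ℤ) → ((M → V) →ₗ[k] V))
    (hpost : NonUniformCA.StablyPostSurjective s)
    (hsing : NonUniformCA.BoundedSingularity s) :
    NonUniformCA.Invertible (NonUniformCA.linearNuca s) := by
  obtain ⟨N, z, hz, hz0, hσ⟩ := hpost.exists_impulse hM
  have hinj := NonUniformCA.linearNuca_injective_of_impulse hM hsing hz hz0 hσ
  have hright : Function.RightInverse (NonUniformCA.superpose N z) (NonUniformCA.linearNuca s) :=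
    NonUniformCA.linearNuca_superpose hM s hz hσ
  refine ⟨⟨hinj, hright.surjective⟩, _, N.finite_toSet.image Neg.neg,
    fun g f => ∑ n : N, z (g - n) (f ⟨-n, n, n.2, rfl⟩) g, ?_, ?_⟩
  · intro x
    rw [NonUniformCA.nuca_eq_superpose]
    exact hright.leftInverse_of_injective hinj x
  · intro y
    rw [NonUniformCA.nuca_eq_superpose]
    exact hright y
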